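/- Let $X_1,X_2,\dots$ be square-integrable, mean-zero random variables on a probability space $(\Omega,\mathcal A,\mathbb P)$ that are associated: for every finite subfamily $(X_{i})_{i\in I}$ and all coordinatewise nondecreasing Borel functions $h,g:\mathbb R^{I}\to\mathbb R$, $\operatorname{Cov}\big(h((X_i)_{i\in I}),g((X_i)_{i\in I})\big)\ge 0$ whenever this covariance exists. Put $S_0=0$, $S_n=X_1+\dots+X_n$, $s_n^2=\operatorname{Var}(S_n)$, $s_n\ge 0$. Let $\ell(n),m(n),r(n)$ be nonnegative integers such that (L) $n=m(n)\ell(n)+r(n)$ with $0\le r(n)<\ell(n)$ for $n\ge1$, and $m(n)\to\infty$, $\ell(n)/n\to0$, $r(n)/n\to 0$ as $n\to\infty$. Write $\ell=\ell(n)$, $m=m(n)$, and, for $j\ge 1$, $\tau_j^2=\operatorname{Var}(S_{j\ell}-S_{(j-1)\ell})=\mathbb E (S_{j\ell}-S_{(j-1)\ell})^2$ (which depends on $n$ through $\ell$) and $\nu_{m(n)}^2=\tau_1^2+\dots+\tau_{m(n)}^2$, $\nu_{m(n)}\ge 0$. Assume (Ha) $\displaystyle \frac{\ell(n)}{s_n^2}\sum_{j=1}^{m(n)}\operatorname{Var}\Big(\frac{S_{j\ell}-S_{(j-1)\ell}}{\sqrt{\ell(n)}}\Big)\to1$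 as $n\to\infty$, and that at least one of the following two conditions holds: (Hab) $\displaystyle \frac1{s_n^2}\operatorname{Var}\Big(\sum_{i=m(n)\ell(n)+1}^{n}X_i\Big)\to0$ as $n\to\infty$; (Hb) $\displaystyle \sup_{1\le j\le m(n)+1}\frac{\ell(n)}{s_n^2}\operatorname{Var}\Big(\frac{S_{j\ell}-S_{(j-1)\ell}}{\sqrt{\ell(n)}}\Big)\to0$ as $n\to\infty$. Then $$\max_{1\le j\le m(n)}\frac{\mathbb E(S_{j\ell}-S_{(j-1)\ell})^2}{s_n^2}\to0\quad\text{and}\quad \frac{S_n}{s_n}\rightsquigarrow\mathcal N(0,1)\qquad\text{as } n\to\infty$$ if and only if, for every $\varepsilon>0$, $$\frac1{s_n^2}\sum_{j=1}^{m(n)}\mathbb E\Big((S_{j\ell}-S_{(j-1)\ell})^2\,\mathbf 1_{\{|S_{j\ell}-S_{(j-1)\ell}|\ge\varepsilon\nu_{m(n)}\}}\Big)\to0\qquad\text{as } n\to\infty .$$ Moreover, the latter condition (for every $\varepsilon>0$) is equivalent to the one in which $\nu_{m(n)}$ is replaced by $s_n$: for every $\varepsilon>0$, $$\frac1{s_n^2}\sum_{j=1}^{m(n)}\mathbb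 E\Big((S_{j\ell}-S_{(j-1)\ell})^2\,\mathbf 1_{\{|S_{j\ell}-S_{(j-1)\ell}|\ge\varepsilon s_n\}}\Big)\to0\qquad\text{as } n\to\infty .$$ -/

import Mathlib

open MeasureTheory ProbabilityTheory Filter Topology

namespace AssocCLT

noncomputable section

/-- A finite family of real random variables is associated if `Cov(h(X), g(X)) ≥ 0` for all
coordinatewise nondecreasing (Borel) `h, g`, whenever this covariance exists. -/
def AssociatedFamily {Ω ι : Type*} [MeasurableSpace Ω] [Fintype ι]
    (P : Measure Ω) (X : ι → Ω → ℝ) : Prop :=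
  ∀ h g : (ι → ℝ) → ℝ, Monotone h → Monotone g → Measurable h → Measurable g →
    Integrable (fun ω => h (fun i => X i ω)) P →
    Integrable (fun ω => g (fun i => X i ω)) P →
    Integrable (fun ω => h (fun i => X i ω) * g (fun i => X i ω)) P →
    0 ≤ cov[fun ω => h (fun i => X i ω), fun ω => g (fun i => X i ω); P]

/-- An infinite sequence is associated if all its finite subfamilies are. -/
def Associated {Ω : Type*} [MeasurableSpace Ω] (P : Measure Ω) (X : ℕ → Ω → ℝ) : Prop :=
  ∀ I : Finset ℕ, AssociatedFamily P (fun i : I => X i)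

/-- Partial sums. The sequence `X₁, X₂, …` is indexed from `0` in Lean, `X i` being `X_{i+1}`, so
that `partialSum X n = X₁ + ⋯ + X_n`. -/
def partialSum {Ω : Type*} (X : ℕ → Ω → ℝ) (n : ℕ) (ω : Ω) : ℝ :=
  ∑ i ∈ Finset.range n, X i ω

/-- `s_n`, the standard deviation of `S_n`. -/
def sd {Ω : Type*} [MeasurableSpace Ω] (P : Measure Ω) (X : ℕ → Ω → ℝ) (n : ℕ) : ℝ :=
  √(Var[partialSum X n; P])

/-- The `j`-th block sum of length `L`, `S_{jL} - S_{(j-1)L}`, for `j ≥ 1`. -/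
def block {Ω : Type*} (X : ℕ → Ω → ℝ) (L j : ℕ) (ω : Ω) : ℝ :=
  partialSum X (j * L) ω - partialSum X ((j - 1) * L) ω

/-- `ν = (τ₁² + ⋯ + τ_M²)^{1/2}`, where `τ_j²` is the variance of the `j`-th block of length `L`. -/
def blockNorm {Ω : Type*} [MeasurableSpace Ω] (P : Measure Ω) (X : ℕ → Ω → ℝ) (L M : ℕ) : ℝ :=
  √(∑ j ∈ Finset.Icc 1 M, Var[block X L j; P])

/-- Condition (L): `n = m(n) ℓ(n) + r(n)` with `0 ≤ r(n) < ℓ(n)`, `m(n) → ∞`, `ℓ(n)/n → 0` and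
`r(n)/n → 0`. -/
def CondL (ℓ m r : ℕ → ℕ) : Prop :=
  (∀ n, 1 ≤ n → n = m n * ℓ n + r n ∧ r n < ℓ n) ∧
  Tendsto m atTop atTop ∧
  Tendsto (fun n => (ℓ n : ℝ) / (n : ℝ)) atTop (𝓝 0) ∧
  Tendsto (fun n => (r n : ℝ) / (n : ℝ)) atTop (𝓝 0)

/-- Condition (Ha). -/
def CondHa {Ω : Type*} [MeasurableSpace Ω] (P : Measure Ω) (X : ℕ → Ω → ℝ)
    (ℓ m : ℕ → ℕ) : Prop :=
  Tendsto (fun n => (ℓ n : ℝ) / sd P X n ^ 2 *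
    ∑ j ∈ Finset.Icc 1 (m n), Var[fun ω => block X (ℓ n) j ω / √(ℓ n : ℝ); P]) atTop (𝓝 1)

/-- Condition (Hab): the variance of the remainder `X_{mℓ+1} + ⋯ + X_n` is `o(s_n²)`. -/
def CondHab {Ω : Type*} [MeasurableSpace Ω] (P : Measure Ω) (X : ℕ → Ω → ℝ)
    (ℓ m : ℕ → ℕ) : Prop :=
  Tendsto (fun n => 1 / sd P X n ^ 2 *
    Var[fun ω => ∑ i ∈ Finset.Ico (m n * ℓ n) n, X i ω; P]) atTop (𝓝 0)

/-- Condition (Hb); the supremum runs over the `m(n) + 1` blocks `1 ≤ j ≤ m(n) + 1`. -/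
def CondHb {Ω : Type*} [MeasurableSpace Ω] (P : Measure Ω) (X : ℕ → Ω → ℝ)
    (ℓ m : ℕ → ℕ) : Prop :=
  Tendsto (fun n => ⨆ j : Finset.Icc 1 (m n + 1), (ℓ n : ℝ) / sd P X n ^ 2 *
    Var[fun ω => block X (ℓ n) j ω / √(ℓ n : ℝ); P]) atTop (𝓝 0)

/-- The largest variance of the blocks `1 ≤ j ≤ m(n)` is `o(s_n²)`. -/
def MaxBlockNegligible {Ω : Type*} [MeasurableSpace Ω] (P : Measure Ω) (X : ℕ → Ω → ℝ)
    (ℓ m : ℕ → ℕ) : Prop :=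
  Tendsto (fun n => (⨆ j : Finset.Icc 1 (m n), ∫ ω, block X (ℓ n) j ω ^ 2 ∂P) / sd P X n ^ 2)
    atTop (𝓝 0)

/-- `S_n / s_n` converges in distribution to `N(0,1)`. -/
def CLT {Ω : Type*} [MeasurableSpace Ω] (P : Measure Ω) [IsProbabilityMeasure P]
    (X : ℕ → Ω → ℝ) : Prop :=
  TendstoInDistribution (fun n ω => partialSum X n ω / sd P X n) atTop
    (id : ℝ → ℝ) (fun _ => P) (gaussianReal 0 1)

/-- The Feller–Lindeberg condition on the block sums, with truncation at `ε * c n`. -/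
def BlockLindeberg {Ω : Type*} [MeasurableSpace Ω] (P : Measure Ω) (X : ℕ → Ω → ℝ)
    (ℓ m : ℕ → ℕ) (c : ℕ → ℝ) : Prop :=
  ∀ ε : ℝ, 0 < ε → Tendsto (fun n => 1 / sd P X n ^ 2 *
    ∑ j ∈ Finset.Icc 1 (m n),
      ∫ ω in {ω | ε * c n ≤ |block X (ℓ n) j ω|}, block X (ℓ n) j ω ^ 2 ∂P) atTop (𝓝 0)

end

end AssocCLT

/-! Association makes covariances of subset sums nonnegative, so `s_n² - ν²` is a sum of nonnegative
terms: the covariances between distinct blocks, those of the blocks with the remainder, and the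
variance of the remainder. (Ha) says exactly that this gap is `o(s_n²)`.

Newman's inequality (`Associated.norm_charFun_add_sub_mul_le`) bounds the failure of a
characteristic function to factor over two subset sums by their covariance. Telescoped over the
blocks and the remainder (`Associated.norm_charFun_partialSum_sub_prod_le_of_le`), it puts the
characteristic function of `S_n / s_n` at `t` within `2t²(1 - ν²/s_n²) → 0` of the product over the
blocks. For the central limit theorem the blocks therefore behave as if independent.

What remains is the Lindeberg–Feller theorem, proved for products of characteristic functions so
that no independent copies are needed: `tendsto_prod_charFun_of_lindeberg` and
`lindeberg_of_tendsto_prod_charFun`. Both replace `∏ φ_j` by `exp (∑ (φ_j - 1))`, which is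
legitimate once the variances are uniformly negligible. The two truncation levels are
interchangeable because `ν / s_n → 1`. -/

namespace AssocCLT

/-! ### Block sums. -/

section Blocks

lemma partialSum_sub_partialSum {Ω : Type*} {X : ℕ → Ω → ℝ} {k n : ℕ} (h : k ≤ n) (ω : Ω) :
    partialSum X n ω - partialSum X k ω = ∑ i ∈ Finset.Ico k n, X i ω := by
  rw [Finset.sum_Ico_eq_sub _ h]
  rfl

lemma partialSum_eq_add {Ω : Type*} {X : ℕ → Ω → ℝ} {k n : ℕ} (h : k ≤ n) (ω : Ω) :
    partialSum X n ω = ∑ i ∈ Finset.range k, X i ω + ∑ i ∈ Finset.Ico k n, X i ω := by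
  rw [← partialSum_sub_partialSum h]
  simp [partialSum]

lemma block_eq_sum {Ω : Type*} {X : ℕ → Ω → ℝ} (L j : ℕ) :
    block X L j = fun ω => ∑ i ∈ Finset.Ico ((j - 1) * L) (j * L), X i ω := by
  ext ω
  exact partialSum_sub_partialSum (Nat.mul_le_mul_right _ (Nat.sub_le _ _)) ω

lemma memLp_block {Ω : Type*} [MeasurableSpace Ω] {P : Measure Ω} {X : ℕ → Ω → ℝ}
    (hL2 : ∀ i, MemLp (X i) 2 P) (L j : ℕ) :
    MemLp (block X L j) 2 P := by
  rw [block_eq_sum]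
  exact memLp_finsetSum _ fun i _ => hL2 i

end Blocks

/-! ### Newman's inequality and approximate factorisation over blocks. -/

section Association

variable {Ω : Type*} [MeasurableSpace Ω] {P : Measure Ω} [IsProbabilityMeasure P]
  {X : ℕ → Ω → ℝ}

/-- Monotone functions of two subset sums of an associated sequence are nonnegatively
correlated. -/
lemma Associated.covariance_comp_sum_nonneg (hX : Associated P X) (A B : Finset ℕ)
    {F G : ℝ → ℝ} (hF : Monotone F) (hG : Monotone G)
    (hFL : MemLp (fun ω => F (∑ i ∈ A, X i ω)) 2 P)
    (hGL : MemLp (fun ω => G (∑ i ∈ B, X i ω)) 2 P) :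
    0 ≤ cov[fun ω => F (∑ i ∈ A, X i ω), fun ω => G (∑ i ∈ B, X i ω); P] := by
  classical
  -- `A` and `B` may differ or overlap, while association concerns one family: both sums are read as
  -- monotone functions on `A ∪ B`, with coefficients 0 and 1.
  have key : ∀ (C : Finset ℕ), C ⊆ A ∪ B → ∀ ω,
      ∑ i : (A ∪ B : Finset ℕ), (if (i : ℕ) ∈ C then X i ω else 0) = ∑ i ∈ C, X i ω := by
    intro C hC ω
    rw [Finset.sum_coe_sort (A ∪ B) (fun i => if i ∈ C then X i ω else 0), ← Finset.sum_filter]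
    congr 1
    ext i
    simp only [Finset.mem_filter]
    exact ⟨fun h => h.2, fun h => ⟨hC h, h⟩⟩
  have hmono : ∀ (C : Finset ℕ), Monotone (fun x : (A ∪ B : Finset ℕ) → ℝ =>
      ∑ i : (A ∪ B : Finset ℕ), (if (i : ℕ) ∈ C then x i else 0)) := by
    intro C x y hxy
    refine Finset.sum_le_sum fun i _ => ?_
    split_ifs
    · exact hxy i
    · exact le_rfl
  have hm : ∀ (C : Finset ℕ), Measurable (fun x : (A ∪ B : Finset ℕ) → ℝ =>
      ∑ i : (A ∪ B : Finset ℕ), (if (i : ℕ) ∈ C then x i else 0)) := by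
    intro C
    refine Finset.measurable_sum _ fun i _ => ?_
    split_ifs
    · exact measurable_pi_apply i
    · exact measurable_const
  have := hX (A ∪ B) _ _ (hF.comp (hmono A)) (hG.comp (hmono B))
    (hF.measurable.comp (hm A)) (hG.measurable.comp (hm B))
  simp only [Function.comp_def, key A Finset.subset_union_left,
    key B Finset.subset_union_right] at this
  exact this (hFL.integrable one_le_two) (hGL.integrable one_le_two) (hFL.integrable_mul hGL)

/-- Covariances of Lipschitz functions of subset sums are controlled by the covariance of the
sums. -/
lemma Associated.abs_covariance_comp_sum_le (hX : Associated P X) (hL2 : ∀ i, MemLp (X i) 2 P)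
    (A B : Finset ℕ) {f g : ℝ → ℝ} {a : ℝ}
    (hf : ∀ x y, |f x - f y| ≤ a * |x - y|) (hg : ∀ x y, |g x - g y| ≤ a * |x - y|)
    (hfL : MemLp (fun ω => f (∑ i ∈ A, X i ω)) 2 P)
    (hgL : MemLp (fun ω => g (∑ i ∈ B, X i ω)) 2 P) :
    |cov[fun ω => f (∑ i ∈ A, X i ω), fun ω => g (∑ i ∈ B, X i ω); P]| ≤
      a ^ 2 * cov[fun ω => ∑ i ∈ A, X i ω, fun ω => ∑ i ∈ B, X i ω; P] := by
  have hU : MemLp (fun ω => a * ∑ i ∈ A, X i ω) 2 P :=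
    (memLp_finsetSum _ fun i _ => hL2 i).const_mul a
  have hV : MemLp (fun ω => a * ∑ i ∈ B, X i ω) 2 P :=
    (memLp_finsetSum _ fun i _ => hL2 i).const_mul a
  -- An `a`-Lipschitz function becomes monotone after adding or subtracting it from `a * x`, so
  -- association applies to all four sign choices.
  have hadd : ∀ {f : ℝ → ℝ}, (∀ x y, |f x - f y| ≤ a * |x - y|) →
      Monotone fun x => a * x + f x := by
    intro f hf x y hxy
    have h1 := abs_le.1 (hf y x)
    rw [abs_of_nonneg (sub_nonneg.2 hxy)] at h1
    have := h1.1
    change a * x + f x ≤ a * y + f y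
    linarith
  have hsub : ∀ {f : ℝ → ℝ}, (∀ x y, |f x - f y| ≤ a * |x - y|) →
      Monotone fun x => a * x - f x := by
    intro f hf x y hxy
    have h1 := abs_le.1 (hf y x)
    rw [abs_of_nonneg (sub_nonneg.2 hxy)] at h1
    have := h1.2
    change a * x - f x ≤ a * y - f y
    linarith
  set U := fun ω => a * ∑ i ∈ A, X i ω with hUdef
  set V := fun ω => a * ∑ i ∈ B, X i ω with hVdef
  set fU := fun ω => f (∑ i ∈ A, X i ω) with hfU
  set gV := fun ω => g (∑ i ∈ B, X i ω) with hgV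
  have e1 : 0 ≤ cov[U + fU, V + gV; P] :=
    hX.covariance_comp_sum_nonneg A B (hadd hf) (hadd hg) (hU.add hfL) (hV.add hgL)
  have e2 : 0 ≤ cov[U - fU, V - gV; P] :=
    hX.covariance_comp_sum_nonneg A B (hsub hf) (hsub hg) (hU.sub hfL) (hV.sub hgL)
  have e3 : 0 ≤ cov[U + fU, V - gV; P] :=
    hX.covariance_comp_sum_nonneg A B (hadd hf) (hsub hg) (hU.add hfL) (hV.sub hgL)
  have e4 : 0 ≤ cov[U - fU, V + gV; P] :=
    hX.covariance_comp_sum_nonneg A B (hsub hf) (hadd hg) (hU.sub hfL) (hV.add hgL)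
  rw [covariance_add_left hU hfL (hV.add hgL), covariance_add_right hU hV hgL,
    covariance_add_right hfL hV hgL] at e1
  rw [covariance_sub_left hU hfL (hV.sub hgL), covariance_sub_right hU hV hgL,
    covariance_sub_right hfL hV hgL] at e2
  rw [covariance_add_left hU hfL (hV.sub hgL), covariance_sub_right hU hV hgL,
    covariance_sub_right hfL hV hgL] at e3
  rw [covariance_sub_left hU hfL (hV.add hgL), covariance_add_right hU hV hgL,
    covariance_add_right hfL hV hgL] at e4
  have e5 : cov[U, V; P] =
      a ^ 2 * cov[fun ω => ∑ i ∈ A, X i ω, fun ω => ∑ i ∈ B, X i ω; P] := by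
    rw [hUdef, hVdef, covariance_const_mul_left, covariance_const_mul_right]
    ring
  rw [← e5, abs_le]
  -- In `e1 + e2` and in `e3 + e4` the mixed terms `cov[U, gV]` and `cov[fU, V]` cancel, leaving
  -- `cov[U, V] ± cov[fU, gV] ≥ 0`.
  constructor <;> linarith

lemma memLp_of_abs_le_one {U : Ω → ℝ} (hU : AEStronglyMeasurable U P) (h : ∀ ω, |U ω| ≤ 1)
    (p : ENNReal) : MemLp U p P :=
  MemLp.of_bound hU 1 (ae_of_all _ h)

lemma memLp_cos_mul {U : Ω → ℝ} (hU : AEMeasurable U P) (a : ℝ) (p : ENNReal) :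
    MemLp (fun ω => Real.cos (a * U ω)) p P :=
  memLp_of_abs_le_one (by fun_prop) (fun _ => Real.abs_cos_le_one _) p

lemma memLp_sin_mul {U : Ω → ℝ} (hU : AEMeasurable U P) (a : ℝ) (p : ENNReal) :
    MemLp (fun ω => Real.sin (a * U ω)) p P :=
  memLp_of_abs_le_one (by fun_prop) (fun _ => Real.abs_sin_le_one _) p

lemma charFun_map_eq_cos_sin {U : Ω → ℝ} (hU : AEMeasurable U P) (a : ℝ) :
    charFun (P.map U) a =
      ((∫ ω, Real.cos (a * U ω) ∂P : ℝ) : ℂ) + ((∫ ω, Real.sin (a * U ω) ∂P : ℝ) : ℂ) *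
        Complex.I := by
  have hc : Integrable (fun ω => Real.cos (a * U ω)) P :=
    (memLp_cos_mul hU a 1).integrable le_rfl
  have hs : Integrable (fun ω => Real.sin (a * U ω)) P :=
    (memLp_sin_mul hU a 1).integrable le_rfl
  rw [charFun_apply_real, integral_map hU (by fun_prop)]
  rw [← integral_complex_ofReal, ← integral_complex_ofReal, ← integral_mul_const,
    ← integral_add hc.ofReal (hs.ofReal.mul_const _)]
  refine integral_congr_ae (ae_of_all _ fun ω => ?_)
  simp only
  rw [← Complex.ofReal_mul, Complex.exp_mul_I, Complex.ofReal_cos, Complex.ofReal_sin]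

/-- By the addition formula, the defect from the independent case is a combination of covariances of
Lipschitz functions, which association controls. -/
lemma integral_cos_add {U V : Ω → ℝ} (hU : AEMeasurable U P) (hV : AEMeasurable V P) (a : ℝ) :
    ∫ ω, Real.cos (a * (U ω + V ω)) ∂P =
      (∫ ω, Real.cos (a * U ω) ∂P) * (∫ ω, Real.cos (a * V ω) ∂P) -
      (∫ ω, Real.sin (a * U ω) ∂P) * (∫ ω, Real.sin (a * V ω) ∂P) +
      (cov[fun ω => Real.cos (a * U ω), fun ω => Real.cos (a * V ω); P] -
        cov[fun ω => Real.sin (a * U ω), fun ω => Real.sin (a * V ω); P]) := by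
  rw [covariance_eq_sub (memLp_cos_mul hU a 2) (memLp_cos_mul hV a 2), covariance_eq_sub (memLp_sin_mul hU a 2) (memLp_sin_mul hV a 2)]
  simp_rw [mul_add, Real.cos_add]
  have e := integral_sub ((memLp_cos_mul hU a 2).integrable_mul (memLp_cos_mul hV a 2)) ((memLp_sin_mul hU a 2).integrable_mul (memLp_sin_mul hV a 2))
  simp only [Pi.mul_apply] at e ⊢
  rw [e]
  ring

lemma integral_sin_add {U V : Ω → ℝ} (hU : AEMeasurable U P) (hV : AEMeasurable V P) (a : ℝ) :
    ∫ ω, Real.sin (a * (U ω + V ω)) ∂P =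
      (∫ ω, Real.sin (a * U ω) ∂P) * (∫ ω, Real.cos (a * V ω) ∂P) +
      (∫ ω, Real.cos (a * U ω) ∂P) * (∫ ω, Real.sin (a * V ω) ∂P) +
      (cov[fun ω => Real.sin (a * U ω), fun ω => Real.cos (a * V ω); P] +
        cov[fun ω => Real.cos (a * U ω), fun ω => Real.sin (a * V ω); P]) := by
  rw [covariance_eq_sub (memLp_sin_mul hU a 2) (memLp_cos_mul hV a 2), covariance_eq_sub (memLp_cos_mul hU a 2) (memLp_sin_mul hV a 2)]
  simp_rw [mul_add, Real.sin_add]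
  have e := integral_add ((memLp_sin_mul hU a 2).integrable_mul (memLp_cos_mul hV a 2)) ((memLp_cos_mul hU a 2).integrable_mul (memLp_sin_mul hV a 2))
  simp only [Pi.mul_apply] at e ⊢
  rw [e]
  ring

lemma abs_cos_mul_sub_cos_mul_le (a x y : ℝ) :
    |Real.cos (a * x) - Real.cos (a * y)| ≤ |a| * |x - y| := by
  rw [← abs_mul, mul_sub]
  simpa [Real.dist_eq] using Real.lipschitzWith_cos.dist_le_mul (a * x) (a * y)

lemma abs_sin_mul_sub_sin_mul_le (a x y : ℝ) :
    |Real.sin (a * x) - Real.sin (a * y)| ≤ |a| * |x - y| := by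
  rw [← abs_mul, mul_sub]
  simpa [Real.dist_eq] using Real.lipschitzWith_sin.dist_le_mul (a * x) (a * y)

/-- Newman's inequality for two subset sums of an associated sequence. -/
lemma Associated.norm_charFun_add_sub_mul_le (hX : Associated P X)
    (hL2 : ∀ i, MemLp (X i) 2 P) (A B : Finset ℕ) (a : ℝ) :
    ‖charFun (P.map fun ω => ∑ i ∈ A, X i ω + ∑ i ∈ B, X i ω) a -
      charFun (P.map fun ω => ∑ i ∈ A, X i ω) a * charFun (P.map fun ω => ∑ i ∈ B, X i ω) a‖ ≤
      4 * a ^ 2 * cov[fun ω => ∑ i ∈ A, X i ω, fun ω => ∑ i ∈ B, X i ω; P] := by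
  have hm : ∀ C : Finset ℕ, AEMeasurable (fun ω => ∑ i ∈ C, X i ω) P :=
    fun C => (memLp_finsetSum C fun i _ => hL2 i).aestronglyMeasurable.aemeasurable
  have hU := hm A
  have hV := hm B
  have cc := hX.abs_covariance_comp_sum_le hL2 A B (abs_cos_mul_sub_cos_mul_le a)
    (abs_cos_mul_sub_cos_mul_le a) (memLp_cos_mul hU a 2) (memLp_cos_mul hV a 2)
  have ss := hX.abs_covariance_comp_sum_le hL2 A B (abs_sin_mul_sub_sin_mul_le a)
    (abs_sin_mul_sub_sin_mul_le a) (memLp_sin_mul hU a 2) (memLp_sin_mul hV a 2)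
  have cs := hX.abs_covariance_comp_sum_le hL2 A B (abs_cos_mul_sub_cos_mul_le a)
    (abs_sin_mul_sub_sin_mul_le a) (memLp_cos_mul hU a 2) (memLp_sin_mul hV a 2)
  have sc := hX.abs_covariance_comp_sum_le hL2 A B (abs_sin_mul_sub_sin_mul_le a)
    (abs_cos_mul_sub_cos_mul_le a) (memLp_sin_mul hU a 2) (memLp_cos_mul hV a 2)
  rw [sq_abs] at cc ss cs sc
  have e := charFun_map_eq_cos_sin (hU.add hV) a
  simp only [Pi.add_def] at e
  rw [e, charFun_map_eq_cos_sin hU, charFun_map_eq_cos_sin hV, integral_cos_add hU hV, integral_sin_add hU hV]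
  -- Real and imaginary parts contribute two covariances each, whence the constant 4.
  refine (Complex.norm_le_abs_re_add_abs_im _).trans ?_
  simp only [Complex.sub_re, Complex.add_re, Complex.ofReal_re, Complex.mul_re, Complex.I_re,
    mul_zero, Complex.ofReal_im, Complex.I_im, mul_one, sub_self, add_zero, Complex.add_im,
    Complex.mul_im, zero_add, Complex.sub_im]
  rw [add_sub_cancel_left]
  set c1 := cov[fun ω => Real.cos (a * ∑ i ∈ A, X i ω), fun ω => Real.cos (a * ∑ i ∈ B, X i ω); P]
  set c2 := cov[fun ω => Real.sin (a * ∑ i ∈ A, X i ω), fun ω => Real.sin (a * ∑ i ∈ B, X i ω); P]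
  set c3 := cov[fun ω => Real.cos (a * ∑ i ∈ A, X i ω), fun ω => Real.sin (a * ∑ i ∈ B, X i ω); P]
  set c4 := cov[fun ω => Real.sin (a * ∑ i ∈ A, X i ω), fun ω => Real.cos (a * ∑ i ∈ B, X i ω); P]
  have h1 := abs_sub c1 c2
  have h2 := abs_add_le c4 c3
  refine (add_le_add h1 (le_of_eq_of_le (congrArg _ ?_) h2)).trans (by linarith)
  ring

/-- The variance of the sum of two subset sums. -/
lemma variance_sum_add_sum (hL2 : ∀ i, MemLp (X i) 2 P) (A B : Finset ℕ) :
    Var[fun ω => ∑ i ∈ A, X i ω + ∑ i ∈ B, X i ω; P] =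
      Var[fun ω => ∑ i ∈ A, X i ω; P] +
        2 * cov[fun ω => ∑ i ∈ A, X i ω, fun ω => ∑ i ∈ B, X i ω; P] +
        Var[fun ω => ∑ i ∈ B, X i ω; P] :=
  variance_fun_add (memLp_finsetSum A fun i _ => hL2 i) (memLp_finsetSum B fun i _ => hL2 i)

lemma integral_block (hL2 : ∀ i, MemLp (X i) 2 P) (hmean : ∀ i, ∫ ω, X i ω ∂P = 0) (L j : ℕ) :
    ∫ ω, block X L j ω ∂P = 0 := by
  rw [block_eq_sum, integral_finsetSum _ fun i _ => (hL2 i).integrable one_le_two]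
  exact Finset.sum_eq_zero fun i _ => hmean i

lemma variance_block (hL2 : ∀ i, MemLp (X i) 2 P) (hmean : ∀ i, ∫ ω, X i ω ∂P = 0) (L j : ℕ) :
    Var[block X L j; P] = ∫ ω, block X L j ω ^ 2 ∂P :=
  variance_of_integral_eq_zero (memLp_block hL2 L j).aestronglyMeasurable.aemeasurable
    (integral_block hL2 hmean L j)

/-- The characteristic function of a sum of consecutive blocks differs from the product of those
of the blocks by at most twice the sum of the off-diagonal covariances. -/
lemma Associated.norm_charFun_partialSum_sub_prod_le (hX : Associated P X)
    (hL2 : ∀ i, MemLp (X i) 2 P) (L M : ℕ) (a : ℝ) :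
    ‖charFun (P.map (partialSum X (M * L))) a -
      ∏ j ∈ Finset.Icc 1 M, charFun (P.map (block X L j)) a‖ ≤
      2 * a ^ 2 * (Var[partialSum X (M * L); P] - ∑ j ∈ Finset.Icc 1 M, Var[block X L j; P]) := by
  induction M with
  | zero =>
    have h0 : partialSum X (0 * L) = fun _ => 0 := by ext; simp [partialSum]
    have hv : Var[fun _ : Ω => (0 : ℝ); P] = 0 := variance_zero P
    rw [h0, hv]
    simp [charFun_dirac]
  | succ M ih =>
    have hle : M * L ≤ (M + 1) * L := Nat.mul_le_mul_right _ (Nat.le_succ _)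
    have hS : partialSum X ((M + 1) * L) = fun ω => ∑ i ∈ Finset.range (M * L), X i ω +
        ∑ i ∈ Finset.Ico (M * L) ((M + 1) * L), X i ω := funext (partialSum_eq_add hle)
    have hB : block X L (M + 1) = fun ω => ∑ i ∈ Finset.Ico (M * L) ((M + 1) * L), X i ω :=
      block_eq_sum L (M + 1)
    have hN := hX.norm_charFun_add_sub_mul_le hL2 (Finset.range (M * L))
      (Finset.Ico (M * L) ((M + 1) * L)) a
    have hV := variance_sum_add_sum (P := P) hL2 (Finset.range (M * L))
      (Finset.Ico (M * L) ((M + 1) * L))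
    rw [← hS, ← hB] at hN hV
    change ‖_ - charFun (P.map (partialSum X (M * L))) a * _‖ ≤ _ at hN
    change _ = Var[partialSum X (M * L); P] + _ + _ at hV
    rw [Finset.prod_Icc_succ_top (by omega), Finset.sum_Icc_succ_top (by omega)]
    set φ := charFun (P.map (block X L (M + 1))) a with hφ
    have hprob : IsProbabilityMeasure (P.map (block X L (M + 1))) :=
      Measure.isProbabilityMeasure_map (memLp_block hL2 L _).aestronglyMeasurable.aemeasurable
    have hφ1 : ‖φ‖ ≤ 1 := norm_charFun_le_one _
    refine (norm_sub_le_norm_sub_add_norm_sub _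
      (charFun (P.map (partialSum X (M * L))) a * φ) _).trans ?_
    rw [← sub_mul, norm_mul]
    have := mul_le_of_le_one_right (norm_nonneg (charFun (P.map (partialSum X (M * L))) a -
      ∏ j ∈ Finset.Icc 1 M, charFun (P.map (block X L j)) a)) hφ1
    -- The new block's variance cancels in the difference, which grows by twice the covariance:
    -- exactly the `4 * a ^ 2 * cov` of Newman's bound.
    rw [hV]
    refine (add_le_add hN (this.trans ih)).trans (le_of_eq ?_)
    change 4 * a ^ 2 * cov[partialSum X (M * L), _; P] + _ = 2 * a ^ 2 *
      (_ + 2 * cov[partialSum X (M * L), _; P] + _ - _)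
    ring

end Association

end AssocCLT

namespace AssocCLT

/-! ### Taylor estimates for characteristic functions. -/

section Expansion

/-- The constants here and below are not sharp; they are chosen to hold for every real `x`, with
Taylor's bound for `|x| ≤ 1` and the triangle inequality beyond. -/
lemma norm_exp_mul_I_sub_linear_le (x : ℝ) :
    ‖Complex.exp (x * Complex.I) - 1 - x * Complex.I‖ ≤ 2 * x ^ 2 := by
  have hn : ‖(x : ℂ) * Complex.I‖ = |x| := by simp
  rcases le_total |x| 1 with h | h
  · have := Complex.norm_exp_sub_one_sub_id_le (x := x * Complex.I) (by rwa [hn])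
    rw [hn, sq_abs] at this
    nlinarith [sq_nonneg x]
  · have h1 : ‖Complex.exp (x * Complex.I) - 1‖ ≤ |x| := by
      simpa [mul_comm] using Real.norm_exp_I_mul_ofReal_sub_one_le (x := x)
    refine (norm_sub_le _ _).trans ?_
    rw [hn]
    nlinarith [sq_abs x]

lemma norm_exp_mul_I_sub_quadratic_le_sq (x : ℝ) :
    ‖Complex.exp (x * Complex.I) - 1 - x * Complex.I + (x : ℂ) ^ 2 / 2‖ ≤ 3 * x ^ 2 := by
  refine (norm_add_le _ _).trans ?_
  have h1 := norm_exp_mul_I_sub_linear_le x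
  have h2 : ‖(x : ℂ) ^ 2 / 2‖ = x ^ 2 / 2 := by simp
  rw [h2]
  nlinarith [sq_nonneg x]

lemma norm_exp_mul_I_sub_quadratic_le_cube (x : ℝ) :
    ‖Complex.exp (x * Complex.I) - 1 - x * Complex.I + (x : ℂ) ^ 2 / 2‖ ≤ 3 * |x| ^ 3 := by
  have hn : ‖(x : ℂ) * Complex.I‖ = |x| := by simp
  rcases le_total |x| 1 with h | h
  · have := Complex.exp_bound (x := x * Complex.I) (by rwa [hn]) (n := 3) (by norm_num)
    rw [hn] at this
    have e : ∑ k ∈ Finset.range 3, ((x : ℂ) * Complex.I) ^ k / (k.factorial : ℂ) =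
        1 + x * Complex.I - (x : ℂ) ^ 2 / 2 := by
      simp [Finset.sum_range_succ, Nat.factorial, mul_pow]
      ring
    rw [e] at this
    rw [show Complex.exp (x * Complex.I) - 1 - x * Complex.I + (x : ℂ) ^ 2 / 2 =
      Complex.exp (x * Complex.I) - (1 + x * Complex.I - (x : ℂ) ^ 2 / 2) by ring]
    refine this.trans ?_
    rw [mul_comm]
    gcongr
    norm_num [Nat.factorial]
  · refine (norm_exp_mul_I_sub_quadratic_le_sq x).trans ?_
    rw [← sq_abs]
    gcongr 3 * ?_
    exact pow_le_pow_right₀ h (by norm_num)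

lemma charFun_map_eq_integral {Ω : Type*} [MeasurableSpace Ω] {P : Measure Ω} {Z : Ω → ℝ}
    (hZ : AEMeasurable Z P) (t : ℝ) :
    charFun (P.map Z) t = ∫ ω, Complex.exp ((t * Z ω : ℝ) * Complex.I) ∂P := by
  rw [charFun_apply_real, integral_map hZ (by fun_prop)]
  simp

variable {Ω : Type*} [MeasurableSpace Ω] {P : Measure Ω} [IsProbabilityMeasure P] {Z : Ω → ℝ}

lemma integrable_exp_mul_I (hZ : AEMeasurable Z P) (t : ℝ) :
    Integrable (fun ω => Complex.exp ((t * Z ω : ℝ) * Complex.I)) P :=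
  Integrable.of_bound (by fun_prop) 1
    (ae_of_all _ fun ω => (Complex.norm_exp_ofReal_mul_I _).le)

/-- Centring allows the linear term to be inserted for free, which makes the integrand quadratically
small. -/
lemma charFun_map_sub_one_eq (hZ : MemLp Z 2 P) (h0 : ∫ ω, Z ω ∂P = 0) (t : ℝ) :
    charFun (P.map Z) t - 1 = ∫ ω, (Complex.exp ((t * Z ω : ℝ) * Complex.I) - 1 -
      (t * Z ω : ℝ) * Complex.I) ∂P := by
  have hm := hZ.aestronglyMeasurable.aemeasurable
  have h1 : Integrable (fun ω => ((t * Z ω : ℝ) : ℂ) * Complex.I) P :=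
    (((hZ.integrable one_le_two).const_mul t).ofReal).mul_const _
  have h2 : Integrable (fun ω => Complex.exp ((t * Z ω : ℝ) * Complex.I) - 1) P :=
    (integrable_exp_mul_I hm t).sub (integrable_const _)
  rw [integral_sub h2 h1,
    integral_sub (integrable_exp_mul_I hm t) (integrable_const _), charFun_map_eq_integral hm,
    integral_mul_const, integral_complex_ofReal, integral_const_mul, h0]
  simp

lemma integrable_exp_mul_I_sub_linear (hZ : MemLp Z 2 P) (t : ℝ) :
    Integrable (fun ω => Complex.exp ((t * Z ω : ℝ) * Complex.I) - 1 -
      (t * Z ω : ℝ) * Complex.I) P :=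
  ((integrable_exp_mul_I hZ.aestronglyMeasurable.aemeasurable t).sub (integrable_const _)).sub
    ((((hZ.integrable one_le_two).const_mul t).ofReal).mul_const _)

/-- Used twice: to bring each factor of a negligible array close to 1, and to drop the remainder
after the last block at the cost of its variance. -/
lemma norm_charFun_map_sub_one_le (hZ : MemLp Z 2 P) (h0 : ∫ ω, Z ω ∂P = 0) (t : ℝ) :
    ‖charFun (P.map Z) t - 1‖ ≤ 2 * t ^ 2 * ∫ ω, Z ω ^ 2 ∂P := by
  rw [charFun_map_sub_one_eq hZ h0, ← integral_const_mul]
  refine norm_integral_le_of_norm_le (hZ.integrable_sq.const_mul _) (ae_of_all _ fun ω => ?_)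
  refine (norm_exp_mul_I_sub_linear_le _).trans (le_of_eq ?_)
  ring

/-- Second order expansion of a characteristic function, with the error split at level `δ`. -/
lemma norm_charFun_map_sub_quadratic_le (hm : Measurable Z) (hZ : MemLp Z 2 P)
    (h0 : ∫ ω, Z ω ∂P = 0) (t : ℝ) {δ : ℝ} (hδ : 0 ≤ δ) :
    ‖charFun (P.map Z) t - 1 + ((t ^ 2 / 2 * ∫ ω, Z ω ^ 2 ∂P : ℝ) : ℂ)‖ ≤
      3 * |t| ^ 3 * δ * (∫ ω, Z ω ^ 2 ∂P) + 3 * t ^ 2 * ∫ ω in {ω | δ ≤ |Z ω|}, Z ω ^ 2 ∂P := by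
  have hset : MeasurableSet {ω | δ ≤ |Z ω|} := measurableSet_le measurable_const hm.abs
  have hsq := hZ.integrable_sq
  have hsq' : Integrable (fun ω => ((t ^ 2 / 2 * Z ω ^ 2 : ℝ) : ℂ)) P :=
    (hsq.const_mul (t ^ 2 / 2)).ofReal
  rw [charFun_map_sub_one_eq hZ h0, ← integral_const_mul, ← integral_complex_ofReal,
    ← integral_add (integrable_exp_mul_I_sub_linear hZ t) hsq',
    ← integral_indicator hset, ← integral_const_mul, ← integral_const_mul,
    ← integral_add (hsq.const_mul _) ((hsq.indicator hset).const_mul _)]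
  refine norm_integral_le_of_norm_le
    ((hsq.const_mul _).add ((hsq.indicator hset).const_mul _)) (ae_of_all _ fun ω => ?_)
  have e : ((t ^ 2 / 2 * Z ω ^ 2 : ℝ) : ℂ) = ((t * Z ω : ℝ) : ℂ) ^ 2 / 2 := by
    push_cast; ring
  rw [e]
  have hq := norm_exp_mul_I_sub_quadratic_le_sq (t * Z ω)
  have hc := norm_exp_mul_I_sub_quadratic_le_cube (t * Z ω)
  -- The quadratic bound serves on the tail; below `δ` the cubic one does, with one factor `|Z ω|`
  -- replaced by `δ`.
  by_cases h : δ ≤ |Z ω|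
  · rw [Set.indicator_of_mem (by exact h)]
    refine hq.trans ?_
    have : 0 ≤ 3 * |t| ^ 3 * δ * Z ω ^ 2 := by positivity
    rw [mul_pow]
    linarith
  · rw [Set.indicator_of_notMem (by exact h)]
    refine hc.trans ?_
    rw [abs_mul, mul_pow, mul_zero, add_zero]
    push Not at h
    have : |Z ω| ^ 3 ≤ δ * Z ω ^ 2 := by
      rw [← sq_abs (Z ω)]
      nlinarith [sq_nonneg |Z ω|]
    have := mul_le_mul_of_nonneg_left this (by positivity : 0 ≤ 3 * |t| ^ 3)
    linarith

/-- The truncated second moment is controlled by the second order expansion of the real part of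
the characteristic function. -/
lemma setIntegral_sq_le_re_charFun_map (hm : Measurable Z) (hZ : MemLp Z 2 P)
    (t : ℝ) {δ : ℝ} (hδ : 0 < δ) :
    (t ^ 2 / 2 - 2 / δ ^ 2) * ∫ ω in {ω | δ ≤ |Z ω|}, Z ω ^ 2 ∂P ≤
      (charFun (P.map Z) t).re - 1 + t ^ 2 / 2 * ∫ ω, Z ω ^ 2 ∂P := by
  have hset : MeasurableSet {ω | δ ≤ |Z ω|} := measurableSet_le measurable_const hm.abs
  have hsq := hZ.integrable_sq
  have hcos : Integrable (fun ω => Real.cos (t * Z ω)) P :=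
    (memLp_cos_mul hm.aemeasurable t 1).integrable le_rfl
  have hre : (charFun (P.map Z) t).re = ∫ ω, Real.cos (t * Z ω) ∂P := by
    rw [charFun_map_eq_cos_sin hm.aemeasurable]
    simp
  have e : (∫ ω, Real.cos (t * Z ω) ∂P) - 1 + t ^ 2 / 2 * ∫ ω, Z ω ^ 2 ∂P =
      ∫ ω, (Real.cos (t * Z ω) - 1 + t ^ 2 / 2 * Z ω ^ 2) ∂P := by
    have h1 : Integrable (fun ω => Real.cos (t * Z ω) - 1) P := hcos.sub (integrable_const _)
    rw [integral_add h1 (hsq.const_mul _),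
      integral_sub hcos (integrable_const _), integral_const_mul]
    simp
  rw [hre, e, ← integral_indicator hset, ← integral_const_mul]
  refine integral_mono ((hsq.indicator hset).const_mul _)
    ((hcos.sub (integrable_const _)).add (hsq.const_mul _)) fun ω => ?_
  simp only
  -- Below `δ` the integrand is nonnegative since `1 - y² / 2 ≤ cos y`. On the tail `cos y - 1 ≥
  -- -2`, and `2` is at most `2 / δ ^ 2 * Z ω ^ 2`.
  by_cases h : δ ≤ |Z ω|
  · rw [Set.indicator_of_mem (by exact h)]
    have h1 := Real.neg_one_le_cos (t * Z ω)
    have h2 : 2 ≤ 2 / δ ^ 2 * Z ω ^ 2 := by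
      rw [div_mul_eq_mul_div, le_div_iff₀ (by positivity), ← sq_abs (Z ω)]
      gcongr
    linarith
  · rw [Set.indicator_of_notMem (by exact h)]
    have := Real.one_sub_sq_div_two_le_cos (x := t * Z ω)
    rw [mul_pow] at this
    linarith

lemma norm_prod_sub_prod_le {ι : Type*} (J : Finset ι) (f g : ι → ℂ) (hf : ∀ j ∈ J, ‖f j‖ ≤ 1)
    (hg : ∀ j ∈ J, ‖g j‖ ≤ 1) :
    ‖∏ j ∈ J, f j - ∏ j ∈ J, g j‖ ≤ ∑ j ∈ J, ‖f j - g j‖ := by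
  classical
  induction J using Finset.induction_on with
  | empty => simp
  | insert i J hi ih =>
    rw [Finset.prod_insert hi, Finset.prod_insert hi, Finset.sum_insert hi]
    have hP : ‖∏ j ∈ J, f j‖ ≤ 1 := by
      rw [norm_prod]
      exact Finset.prod_le_one (fun _ _ => norm_nonneg _)
        fun j hj => hf j (Finset.mem_insert_of_mem hj)
    have ih' := ih (fun j hj => hf j (Finset.mem_insert_of_mem hj))
      (fun j hj => hg j (Finset.mem_insert_of_mem hj))
    rw [show f i * ∏ j ∈ J, f j - g i * ∏ j ∈ J, g j =
      (f i - g i) * ∏ j ∈ J, f j + g i * (∏ j ∈ J, f j - ∏ j ∈ J, g j) by ring]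
    refine (norm_add_le _ _).trans (add_le_add ?_ ?_)
    · rw [norm_mul]
      exact mul_le_of_le_one_right (norm_nonneg _) hP
    · rw [norm_mul]
      exact (mul_le_of_le_one_left (norm_nonneg _) (hg i (Finset.mem_insert_self _ _))).trans ih'

end Expansion

/-! ### Lindeberg–Feller for products of characteristic functions. -/

section TriangularArray

lemma tendsto_zero_of_forall_eventually_norm_le {E : Type*} [SeminormedAddCommGroup E]
    {f : ℕ → E} (C : ℝ) (h : ∀ ε : ℝ, 0 < ε → ∀ᶠ n in atTop, ‖f n‖ ≤ C * ε) :
    Tendsto f atTop (𝓝 0) := by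
  rw [Metric.tendsto_nhds]
  intro η hη
  have hC : 0 < |C| + 1 := by positivity
  filter_upwards [h (η / (|C| + 1)) (by positivity)] with n hn
  rw [dist_zero_right]
  refine hn.trans_lt ?_
  rw [mul_div_assoc', div_lt_iff₀ hC]
  nlinarith [le_abs_self C]

variable {Ω ι : Type*} [MeasurableSpace Ω] {P : Measure Ω} [IsProbabilityMeasure P]
  {Y : ℕ → ι → Ω → ℝ} {J : ℕ → Finset ι} {s : ℕ → ℝ}

/-- If the individual variances are uniformly negligible, the product of the characteristic
functions of the row is asymptotically that of the accompanying compound Poisson law. -/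
lemma tendsto_prod_charFun_sub_exp_sum (hL2 : ∀ n j, MemLp (Y n j) 2 P)
    (hmean : ∀ n j, ∫ ω, Y n j ω ∂P = 0) (hs : ∀ᶠ n in atTop, 0 < s n)
    (hvar : Tendsto (fun n => (∑ j ∈ J n, ∫ ω, Y n j ω ^ 2 ∂P) / s n ^ 2) atTop (𝓝 1))
    (hneg : ∀ ε : ℝ, 0 < ε → ∀ᶠ n in atTop, ∀ j ∈ J n, ∫ ω, Y n j ω ^ 2 ∂P ≤ ε * s n ^ 2)
    (t : ℝ) :
    Tendsto (fun n => ∏ j ∈ J n, charFun (P.map (Y n j)) (t / s n) -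
      Complex.exp (∑ j ∈ J n, (charFun (P.map (Y n j)) (t / s n) - 1))) atTop (𝓝 0) := by
  have hprob : ∀ n j, IsProbabilityMeasure (P.map (Y n j)) := fun n j =>
    Measure.isProbabilityMeasure_map (hL2 n j).aestronglyMeasurable.aemeasurable
  -- `4 * t ^ 4` comes from squaring `2 * t ^ 2 * v`, and a further factor 2 from the normalised
  -- variances having sum at most 2.
  refine tendsto_zero_of_forall_eventually_norm_le (8 * t ^ 4) fun ε hε => ?_
  -- This level of negligibility forces `‖φ j - 1‖ ≤ 1`, the range of the quadratic bound for `exp`.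
  have hsmall : 0 < 1 / (2 * t ^ 2 + 1) := by positivity
  filter_upwards [hs, hneg ε hε, hneg _ hsmall, hvar.eventually_le_const one_lt_two]
    with n hsn h1 h2 h3
  have hs2 : 0 < s n ^ 2 := by positivity
  set φ := fun j => charFun (P.map (Y n j)) (t / s n) with hφ
  have hφ1 : ∀ j, ‖φ j‖ ≤ 1 := fun j => norm_charFun_le_one _
  rw [Complex.exp_sum]
  refine (norm_prod_sub_prod_le _ _ _ (fun j _ => hφ1 j) fun j _ => ?_).trans ?_
  · rw [Complex.norm_exp, Real.exp_le_one_iff, Complex.sub_re, Complex.one_re]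
    linarith [(Complex.re_le_norm (φ j)).trans (hφ1 j)]
  have hbound : ∀ j ∈ J n, ‖φ j - Complex.exp (φ j - 1)‖ ≤
      4 * t ^ 4 * ε * ((∫ ω, Y n j ω ^ 2 ∂P) / s n ^ 2) := by
    intro j hj
    set v := (∫ ω, Y n j ω ^ 2 ∂P) / s n ^ 2 with hv
    have hv0 : 0 ≤ v := div_nonneg (integral_nonneg fun ω => sq_nonneg _) hs2.le
    have hvε : v ≤ ε := (div_le_iff₀ hs2).2 (h1 j hj)
    have hvs : v ≤ 1 / (2 * t ^ 2 + 1) := (div_le_iff₀ hs2).2 (h2 j hj)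
    have hw : ‖φ j - 1‖ ≤ 2 * t ^ 2 * v := by
      refine (norm_charFun_map_sub_one_le (hL2 n j) (hmean n j) _).trans (le_of_eq ?_)
      rw [hv, div_pow]
      ring
    have hw1 : ‖φ j - 1‖ ≤ 1 := by
      refine hw.trans ((mul_le_mul_of_nonneg_left hvs (by positivity)).trans ?_)
      rw [mul_one_div, div_le_one (by positivity)]
      linarith
    have he := Complex.norm_exp_sub_one_sub_id_le hw1
    rw [← norm_neg, show -(φ j - Complex.exp (φ j - 1)) =
      Complex.exp (φ j - 1) - 1 - (φ j - 1) by ring]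
    refine he.trans ((pow_le_pow_left₀ (norm_nonneg _) hw 2).trans ?_)
    have := mul_le_mul_of_nonneg_right hvε hv0
    have := mul_le_mul_of_nonneg_left this (by positivity : 0 ≤ 4 * t ^ 4)
    calc (2 * t ^ 2 * v) ^ 2 = 4 * t ^ 4 * (v * v) := by ring
      _ ≤ _ := this
      _ = _ := by ring
  refine (Finset.sum_le_sum hbound).trans ?_
  rw [← Finset.mul_sum, ← Finset.sum_div]
  refine (mul_le_mul_of_nonneg_left h3 (by positivity)).trans (le_of_eq ?_)
  ring

/-- The Lindeberg condition makes the individual variances uniformly negligible. -/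
lemma negligible_of_lindeberg (hm : ∀ n j, Measurable (Y n j)) (hL2 : ∀ n j, MemLp (Y n j) 2 P)
    (hs : ∀ᶠ n in atTop, 0 < s n)
    (hlin : ∀ ε : ℝ, 0 < ε → Tendsto (fun n => 1 / s n ^ 2 * ∑ j ∈ J n,
      ∫ ω in {ω | ε * s n ≤ |Y n j ω|}, Y n j ω ^ 2 ∂P) atTop (𝓝 0))
    {ε : ℝ} (hε : 0 < ε) : ∀ᶠ n in atTop, ∀ j ∈ J n, ∫ ω, Y n j ω ^ 2 ∂P ≤ ε * s n ^ 2 := by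
  -- With this level, the part below truncation is at most `ε / 2 * s n ^ 2`; the Lindeberg tail
  -- supplies the other half.
  have hδ : 0 < √(ε / 2) := by positivity
  filter_upwards [hs, (hlin _ hδ).eventually_le_const (half_pos hε)] with n hsn h1 j hj
  have hs2 : 0 < s n ^ 2 := by positivity
  rw [one_div_mul_eq_div, div_le_iff₀ hs2] at h1
  have h2 : ∫ ω in {ω | √(ε / 2) * s n ≤ |Y n j ω|}, Y n j ω ^ 2 ∂P ≤ ε / 2 * s n ^ 2 :=
    (Finset.single_le_sum (f := fun j => ∫ ω in {ω | √(ε / 2) * s n ≤ |Y n j ω|}, Y n j ω ^ 2 ∂P)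
      (fun i _ => integral_nonneg fun ω => sq_nonneg _) hj).trans h1
  have hset : MeasurableSet {ω | √(ε / 2) * s n ≤ |Y n j ω|} :=
    measurableSet_le measurable_const (hm n j).abs
  have hsq := (hL2 n j).integrable_sq
  rw [← integral_add_compl hset hsq]
  have h3 : ∫ ω in {ω | √(ε / 2) * s n ≤ |Y n j ω|}ᶜ, Y n j ω ^ 2 ∂P ≤ ε / 2 * s n ^ 2 := by
    rw [← integral_indicator hset.compl]
    calc _ ≤ ∫ _, ε / 2 * s n ^ 2 ∂P := by
          refine integral_mono (hsq.indicator hset.compl) (integrable_const _) fun ω => ?_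
          by_cases h : √(ε / 2) * s n ≤ |Y n j ω|
          · rw [Set.indicator_of_notMem (by simpa using h)]
            positivity
          · rw [Set.indicator_of_mem (by simpa using h)]
            push Not at h
            have := pow_le_pow_left₀ (abs_nonneg _) h.le 2
            rwa [sq_abs, mul_pow, Real.sq_sqrt (by positivity)] at this
      _ = _ := by simp
  linarith

/-- Lindeberg's theorem at the level of characteristic functions. -/
lemma tendsto_prod_charFun_of_lindeberg (hm : ∀ n j, Measurable (Y n j))
    (hL2 : ∀ n j, MemLp (Y n j) 2 P)
    (hmean : ∀ n j, ∫ ω, Y n j ω ∂P = 0) (hs : ∀ᶠ n in atTop, 0 < s n)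
    (hvar : Tendsto (fun n => (∑ j ∈ J n, ∫ ω, Y n j ω ^ 2 ∂P) / s n ^ 2) atTop (𝓝 1))
    (hlin : ∀ ε : ℝ, 0 < ε → Tendsto (fun n => 1 / s n ^ 2 * ∑ j ∈ J n,
      ∫ ω in {ω | ε * s n ≤ |Y n j ω|}, Y n j ω ^ 2 ∂P) atTop (𝓝 0)) (t : ℝ) :
    Tendsto (fun n => ∏ j ∈ J n, charFun (P.map (Y n j)) (t / s n)) atTop
      (𝓝 (Complex.exp (-(t ^ 2 / 2 : ℝ)))) := by
  have hprod := tendsto_prod_charFun_sub_exp_sum hL2 hmean hs hvar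
    (fun ε hε => negligible_of_lindeberg hm hL2 hs hlin hε) t
  have hvar' : Tendsto (fun n => ((t ^ 2 / 2 * ((∑ j ∈ J n, ∫ ω, Y n j ω ^ 2 ∂P) / s n ^ 2) : ℝ) :
      ℂ)) atTop (𝓝 ((t ^ 2 / 2 : ℝ) : ℂ)) := by
    have := hvar.const_mul (t ^ 2 / 2)
    rw [mul_one] at this
    exact (Complex.continuous_ofReal.tendsto _).comp this
  have hsum : Tendsto (fun n => ∑ j ∈ J n, (charFun (P.map (Y n j)) (t / s n) - 1) +
      ((t ^ 2 / 2 * ((∑ j ∈ J n, ∫ ω, Y n j ω ^ 2 ∂P) / s n ^ 2) : ℝ) : ℂ)) atTop (𝓝 0) := by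
    -- The truncation level is `ε * s n`: the cubic part gives `3 * |t| ^ 3 * ε` times a variance
    -- ratio at most 2, the tail gives `3 * t ^ 2 * ε`.
    refine tendsto_zero_of_forall_eventually_norm_le (6 * |t| ^ 3 + 3 * t ^ 2) fun ε hε => ?_
    filter_upwards [hs, hvar.eventually_le_const one_lt_two, (hlin ε hε).eventually_le_const hε]
      with n hsn h1 h2
    have e : ∑ j ∈ J n, (charFun (P.map (Y n j)) (t / s n) - 1) +
        ((t ^ 2 / 2 * ((∑ j ∈ J n, ∫ ω, Y n j ω ^ 2 ∂P) / s n ^ 2) : ℝ) : ℂ) =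
        ∑ j ∈ J n, (charFun (P.map (Y n j)) (t / s n) - 1 +
          (((t / s n) ^ 2 / 2 * ∫ ω, Y n j ω ^ 2 ∂P : ℝ) : ℂ)) := by
      rw [Finset.sum_add_distrib]
      congr 1
      rw [← Complex.ofReal_sum, ← Finset.mul_sum]
      congr 1
      ring
    rw [e]
    refine (norm_sum_le _ _).trans ((Finset.sum_le_sum fun j _ =>
      norm_charFun_map_sub_quadratic_le (hm n j) (hL2 n j) (hmean n j) (t / s n)
        (mul_pos hε hsn).le).trans ?_)
    rw [Finset.sum_add_distrib, ← Finset.mul_sum, ← Finset.mul_sum]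
    have e1 : 3 * |t / s n| ^ 3 * (ε * s n) * ∑ j ∈ J n, ∫ ω, Y n j ω ^ 2 ∂P =
        3 * |t| ^ 3 * ε * ((∑ j ∈ J n, ∫ ω, Y n j ω ^ 2 ∂P) / s n ^ 2) := by
      rw [abs_div, abs_of_pos hsn]
      field_simp
    have e2 : 3 * (t / s n) ^ 2 * ∑ j ∈ J n,
        ∫ ω in {ω | ε * s n ≤ |Y n j ω|}, Y n j ω ^ 2 ∂P = 3 * t ^ 2 * (1 / s n ^ 2 * ∑ j ∈ J n,
        ∫ ω in {ω | ε * s n ≤ |Y n j ω|}, Y n j ω ^ 2 ∂P) := by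
      ring
    rw [e1, e2]
    have g1 := mul_le_mul_of_nonneg_left h1 (by positivity : 0 ≤ 3 * |t| ^ 3 * ε)
    have g2 := mul_le_mul_of_nonneg_left h2 (by positivity : 0 ≤ 3 * t ^ 2)
    linarith
  have hexp := (Complex.continuous_exp.tendsto _).comp (hsum.sub hvar')
  have := hprod.add hexp
  simpa [Function.comp_def] using this

/-- Feller's converse to Lindeberg's theorem at the level of characteristic functions. -/
lemma lindeberg_of_tendsto_prod_charFun (hm : ∀ n j, Measurable (Y n j))
    (hL2 : ∀ n j, MemLp (Y n j) 2 P)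
    (hmean : ∀ n j, ∫ ω, Y n j ω ∂P = 0) (hs : ∀ᶠ n in atTop, 0 < s n)
    (hvar : Tendsto (fun n => (∑ j ∈ J n, ∫ ω, Y n j ω ^ 2 ∂P) / s n ^ 2) atTop (𝓝 1))
    (hneg : ∀ ε : ℝ, 0 < ε → ∀ᶠ n in atTop, ∀ j ∈ J n, ∫ ω, Y n j ω ^ 2 ∂P ≤ ε * s n ^ 2)
    (hlim : ∀ t : ℝ, Tendsto (fun n => ∏ j ∈ J n, charFun (P.map (Y n j)) (t / s n)) atTop
      (𝓝 (Complex.exp (-(t ^ 2 / 2 : ℝ))))) {ε : ℝ} (hε : 0 < ε) :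
    Tendsto (fun n => 1 / s n ^ 2 * ∑ j ∈ J n,
      ∫ ω in {ω | ε * s n ≤ |Y n j ω|}, Y n j ω ^ 2 ∂P) atTop (𝓝 0) := by
  -- Chosen so that `t ^ 2 / 2 - 2 / ε ^ 2 = 1`: a single frequency per `ε` bounds the truncated
  -- second moment with coefficient 1.
  set t : ℝ := √(2 * (1 + 2 / ε ^ 2)) with ht
  have ht2 : t ^ 2 / 2 = 1 + 2 / ε ^ 2 := by
    rw [ht, Real.sq_sqrt (by positivity)]
    ring
  have hexp : Tendsto (fun n => Complex.exp (∑ j ∈ J n,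
      (charFun (P.map (Y n j)) (t / s n) - 1))) atTop (𝓝 (Complex.exp (-(t ^ 2 / 2 : ℝ)))) := by
    simpa using (hlim t).sub (tendsto_prod_charFun_sub_exp_sum hL2 hmean hs hvar hneg t)
  have hre : Tendsto (fun n => ∑ j ∈ J n, ((charFun (P.map (Y n j)) (t / s n)).re - 1)) atTop
      (𝓝 (-(t ^ 2 / 2))) := by
    -- Taking moduli leaves the exponential of a real part, so the real logarithm suffices and no
    -- complex branch enters.
    have h1 := hexp.norm
    simp only [Complex.norm_exp] at h1
    have h2 := h1.log (Real.exp_pos _).ne'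
    simpa only [Real.log_exp, Complex.re_sum, Complex.sub_re, Complex.one_re, Complex.neg_re,
      Complex.ofReal_re] using h2
  have hup := hre.add (hvar.const_mul (t ^ 2 / 2))
  rw [mul_one, neg_add_cancel] at hup
  refine squeeze_zero' (Eventually.of_forall fun n => ?_) ?_ hup
  · exact mul_nonneg (by positivity) (Finset.sum_nonneg fun j _ =>
      integral_nonneg fun ω => sq_nonneg _)
  filter_upwards [hs] with n hsn
  have e : ∑ j ∈ J n, ((charFun (P.map (Y n j)) (t / s n)).re - 1) +
      t ^ 2 / 2 * ((∑ j ∈ J n, ∫ ω, Y n j ω ^ 2 ∂P) / s n ^ 2) =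
      ∑ j ∈ J n, ((charFun (P.map (Y n j)) (t / s n)).re - 1 +
        (t / s n) ^ 2 / 2 * ∫ ω, Y n j ω ^ 2 ∂P) := by
    rw [Finset.sum_add_distrib, ← Finset.mul_sum]
    ring
  rw [e, Finset.mul_sum]
  refine Finset.sum_le_sum fun j _ => ?_
  refine le_of_eq_of_le ?_ (setIntegral_sq_le_re_charFun_map (hm n j) (hL2 n j) (t / s n)
    (mul_pos hε hsn))
  congr 1
  have : (t / s n) ^ 2 / 2 - 2 / (ε * s n) ^ 2 = (t ^ 2 / 2 - 2 / ε ^ 2) / s n ^ 2 := by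
    field_simp
  rw [this, ht2]
  ring

end TriangularArray

end AssocCLT

namespace AssocCLT

/-! ### Consequences of the block conditions, and comparison with a remainder. -/

section BlockConditions

variable {Ω : Type*} [MeasurableSpace Ω] {P : Measure Ω} {X : ℕ → Ω → ℝ}
  {ℓ m r : ℕ → ℕ}

lemma CondHa.eventually_sd_pos (h : CondHa P X ℓ m) : ∀ᶠ n in atTop, 0 < sd P X n := by
  -- Where `s_n = 0`, division by zero makes the quantity in (Ha) equal to 0, which is excluded near
  -- the limit 1.
  filter_upwards [h.eventually_ne one_ne_zero] with n hn
  refine lt_of_le_of_ne (Real.sqrt_nonneg _) fun h0 => hn ?_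
  rw [← h0]
  simp

lemma CondHa.tendsto_sum_variance_block (h : CondHa P X ℓ m) (hL : CondL ℓ m r) :
    Tendsto (fun n => (∑ j ∈ Finset.Icc 1 (m n), Var[block X (ℓ n) j; P]) / sd P X n ^ 2)
      atTop (𝓝 1) := by
  refine Tendsto.congr' ?_ h
  filter_upwards [eventually_ge_atTop 1] with n hn
  have hℓ : (0 : ℝ) < ℓ n := by
    have := (hL.1 n hn).2
    exact_mod_cast (Nat.zero_le _).trans_lt this
  have hv : ∀ j, Var[fun ω => block X (ℓ n) j ω / √(ℓ n : ℝ); P] =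
      Var[block X (ℓ n) j; P] / ℓ n := by
    intro j
    simp_rw [div_eq_mul_inv]
    rw [variance_mul_const, inv_pow, Real.sq_sqrt hℓ.le]
  simp_rw [hv, ← Finset.sum_div]
  field_simp

/-- Converts the supremum into the uniform bound used for triangular arrays. If `m n = 0` the
supremum is 0 by convention, so both sides remain consistent. -/
lemma maxBlockNegligible_iff (hs : ∀ᶠ n in atTop, 0 < sd P X n) :
    MaxBlockNegligible P X ℓ m ↔ ∀ ε : ℝ, 0 < ε → ∀ᶠ n in atTop, ∀ j ∈ Finset.Icc 1 (m n),
      ∫ ω, block X (ℓ n) j ω ^ 2 ∂P ≤ ε * sd P X n ^ 2 := by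
  have h0 : ∀ n j, 0 ≤ ∫ ω, block X (ℓ n) j ω ^ 2 ∂P :=
    fun n j => integral_nonneg fun ω => sq_nonneg _
  constructor
  · intro h ε hε
    filter_upwards [hs, h.eventually_le_const hε] with n hsn hn j hj
    rw [div_le_iff₀ (by positivity)] at hn
    exact (le_ciSup (f := fun j : Finset.Icc 1 (m n) => ∫ ω, block X (ℓ n) j ω ^ 2 ∂P)
      (Set.finite_range _).bddAbove ⟨j, hj⟩).trans hn
  · intro h
    refine tendsto_zero_of_forall_eventually_norm_le 1 fun ε hε => ?_
    filter_upwards [hs, h ε hε] with n hsn hn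
    have hnn : 0 ≤ ⨆ j : Finset.Icc 1 (m n), ∫ ω, block X (ℓ n) j ω ^ 2 ∂P :=
      Real.iSup_nonneg fun j => h0 n j
    rw [Real.norm_of_nonneg (div_nonneg hnn (by positivity)),
      one_mul, div_le_iff₀ (by positivity)]
    exact Real.iSup_le (fun j => hn j j.2) (by positivity)

/-- The Lindeberg condition is monotone in the truncation level. -/
lemma BlockLindeberg.of_le_mul (hL2 : ∀ i, MemLp (X i) 2 P)
    {c d : ℕ → ℝ} {K : ℝ} (hK : 0 < K) (hcd : ∀ᶠ n in atTop, c n ≤ K * d n)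
    (h : BlockLindeberg P X ℓ m c) : BlockLindeberg P X ℓ m d := by
  intro ε hε
  refine squeeze_zero' (Eventually.of_forall fun n => ?_) ?_ (h (ε / K) (by positivity))
  · exact mul_nonneg (by positivity) (Finset.sum_nonneg fun j _ =>
      integral_nonneg fun ω => sq_nonneg _)
  filter_upwards [hcd] with n hn
  refine mul_le_mul_of_nonneg_left (Finset.sum_le_sum fun j _ => ?_) (by positivity)
  refine setIntegral_mono_set (memLp_block hL2 _ _).integrable_sq.integrableOn
    (ae_of_all _ fun ω => sq_nonneg _) (ae_of_all _ fun ω (hω : ε * d n ≤ _) => ?_)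
  change ε / K * c n ≤ _
  refine le_trans ?_ hω
  calc ε / K * c n ≤ ε / K * (K * d n) := by gcongr
    _ = ε * d n := by field_simp

variable [IsProbabilityMeasure P]

/-- Comparison of the characteristic function of a partial sum with the product of those of its
blocks, for block decompositions with a remainder. -/
lemma Associated.norm_charFun_partialSum_sub_prod_le_of_le (hX : Associated P X)
    (hL2 : ∀ i, MemLp (X i) 2 P) (hmean : ∀ i, ∫ ω, X i ω ∂P = 0) {L M n : ℕ} (h : M * L ≤ n)
    (a : ℝ) :
    ‖charFun (P.map (partialSum X n)) a -
      ∏ j ∈ Finset.Icc 1 M, charFun (P.map (block X L j)) a‖ ≤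
      2 * a ^ 2 * (Var[partialSum X n; P] - ∑ j ∈ Finset.Icc 1 M, Var[block X L j; P]) := by
  set R := fun ω => ∑ i ∈ Finset.Ico (M * L) n, X i ω with hR
  have hRL : MemLp R 2 P := memLp_finsetSum _ fun i _ => hL2 i
  have hR0 : ∫ ω, R ω ∂P = 0 := by
    rw [hR, integral_finsetSum _ fun i _ => (hL2 i).integrable one_le_two]
    exact Finset.sum_eq_zero fun i _ => hmean i
  have hRv : Var[R; P] = ∫ ω, R ω ^ 2 ∂P :=
    variance_of_integral_eq_zero hRL.aestronglyMeasurable.aemeasurable hR0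
  have hS : partialSum X n = fun ω => ∑ i ∈ Finset.range (M * L), X i ω +
      ∑ i ∈ Finset.Ico (M * L) n, X i ω := funext (partialSum_eq_add h)
  have hN := hX.norm_charFun_add_sub_mul_le hL2 (Finset.range (M * L)) (Finset.Ico (M * L) n) a
  have hV := variance_sum_add_sum (P := P) hL2 (Finset.range (M * L)) (Finset.Ico (M * L) n)
  rw [← hS] at hN hV
  set U := fun ω => ∑ i ∈ Finset.range (M * L), X i ω with hU
  have hUS : partialSum X (M * L) = U := rfl
  have hUL : MemLp U 2 P := memLp_finsetSum _ fun i _ => hL2 i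
  have hB := hX.norm_charFun_partialSum_sub_prod_le hL2 L M a
  rw [hUS] at hB
  have hprob : IsProbabilityMeasure (P.map U) :=
    Measure.isProbabilityMeasure_map hUL.aestronglyMeasurable.aemeasurable
  have hU1 : ‖charFun (P.map U) a‖ ≤ 1 := norm_charFun_le_one _
  have hR1 := norm_charFun_map_sub_one_le hRL hR0 a
  rw [← hRv] at hR1
  have hmul : ‖charFun (P.map U) a * (charFun (P.map R) a - 1)‖ ≤ 2 * a ^ 2 * Var[R; P] := by
    rw [norm_mul]
    exact (mul_le_of_le_one_left (norm_nonneg _) hU1).trans hR1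
  rw [show charFun (P.map (partialSum X n)) a -
      ∏ j ∈ Finset.Icc 1 M, charFun (P.map (block X L j)) a =
      (charFun (P.map (partialSum X n)) a - charFun (P.map U) a * charFun (P.map R) a) +
      charFun (P.map U) a * (charFun (P.map R) a - 1) +
      (charFun (P.map U) a - ∏ j ∈ Finset.Icc 1 M, charFun (P.map (block X L j)) a) by ring]
  -- The three errors are `4a²` times the covariance with the remainder, `2a²` times the remainder's
  -- variance, and `2a²` times the gap for full blocks; they add up exactly to the gap for `n`.
  refine norm_add₃_le.trans ((add_le_add (add_le_add hN hmul) hB).trans (le_of_eq ?_))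
  rw [hV]
  ring

/-- The preceding bound at `a = 1` dominates a norm, so the variance gap is nonnegative. -/
lemma Associated.sum_variance_block_le_of_le (hX : Associated P X)
    (hL2 : ∀ i, MemLp (X i) 2 P) (hmean : ∀ i, ∫ ω, X i ω ∂P = 0) {L M n : ℕ} (h : M * L ≤ n) :
    ∑ j ∈ Finset.Icc 1 M, Var[block X L j; P] ≤ Var[partialSum X n; P] := by
  have h := (norm_nonneg _).trans (hX.norm_charFun_partialSum_sub_prod_le_of_le hL2 hmean h 1)
  linarith

/-- Lévy's continuity theorem, with the normalisation moved from the variable to the argument. -/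
lemma clt_iff_tendsto_charFun (hmeas : ∀ i, Measurable (X i)) :
    CLT P X ↔ ∀ t : ℝ, Tendsto (fun n => charFun (P.map (partialSum X n)) (t / sd P X n)) atTop
      (𝓝 (Complex.exp (-(t ^ 2 / 2 : ℝ)))) := by
  have hS : ∀ n, Measurable (partialSum X n) := fun n => by
    unfold partialSum
    exact Finset.measurable_sum _ fun i _ => hmeas i
  have hS' : ∀ n, AEMeasurable (fun ω => partialSum X n ω / sd P X n) P :=
    fun n => ((hS n).div_const _).aemeasurable
  have hcf : ∀ n t, charFun (P.map fun ω => partialSum X n ω / sd P X n) t =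
      charFun (P.map (partialSum X n)) (t / sd P X n) := by
    intro n t
    rw [charFun_map_eq_integral (hS' n), charFun_map_eq_integral (hS n).aemeasurable]
    refine integral_congr_ae (ae_of_all _ fun ω => ?_)
    simp only
    congr 3
    ring
  have hg : ∀ t : ℝ, charFun ((gaussianReal 0 1).map (id : ℝ → ℝ)) t =
      Complex.exp (-(t ^ 2 / 2 : ℝ)) := by
    intro t
    rw [Measure.map_id, charFun_gaussianReal]
    congr 1
    push_cast
    simp
  constructor
  · intro h t
    have := ProbabilityMeasure.tendsto_iff_tendsto_charFun.1 h.tendsto t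
    simpa only [ProbabilityMeasure.coe_mk, hcf, hg] using this
  · intro h
    refine ⟨hS', by fun_prop, ProbabilityMeasure.tendsto_iff_tendsto_charFun.2 fun t => ?_⟩
    simpa only [ProbabilityMeasure.coe_mk, hcf, hg] using h t

end BlockConditions

end AssocCLT

/-! ### The main theorem. -/

theorem theorem2 {Ω : Type*} [MeasurableSpace Ω] (P : Measure Ω) [IsProbabilityMeasure P]
    (X : ℕ → Ω → ℝ) (hmeas : ∀ i, Measurable (X i)) (hL2 : ∀ i, MemLp (X i) 2 P)
    (hmean : ∀ i, ∫ ω, X i ω ∂P = 0) (hassoc : AssocCLT.Associated P X)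
    (ℓ m r : ℕ → ℕ) (hL : AssocCLT.CondL ℓ m r) (hHa : AssocCLT.CondHa P X ℓ m)
    (hHabHb : AssocCLT.CondHab P X ℓ m ∨ AssocCLT.CondHb P X ℓ m) :
    ((AssocCLT.MaxBlockNegligible P X ℓ m ∧ AssocCLT.CLT P X) ↔
      AssocCLT.BlockLindeberg P X ℓ m (fun n => AssocCLT.blockNorm P X (ℓ n) (m n))) ∧
    (AssocCLT.BlockLindeberg P X ℓ m (fun n => AssocCLT.blockNorm P X (ℓ n) (m n)) ↔
      AssocCLT.BlockLindeberg P X ℓ m (fun n => AssocCLT.sd P X n)) := by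
  have hs := hHa.eventually_sd_pos
  have hvar := hHa.tendsto_sum_variance_block hL
  have hle : ∀ n, 1 ≤ n → m n * ℓ n ≤ n := fun n hn => by
    have := (hL.1 n hn).1
    omega
  have hsd : ∀ n, AssocCLT.sd P X n ^ 2 = Var[AssocCLT.partialSum X n; P] :=
    fun n => Real.sq_sqrt (variance_nonneg _ _)
  have hequiv : AssocCLT.BlockLindeberg P X ℓ m
      (fun n => AssocCLT.blockNorm P X (ℓ n) (m n)) ↔
      AssocCLT.BlockLindeberg P X ℓ m (fun n => AssocCLT.sd P X n) := by
    constructor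
    · refine AssocCLT.BlockLindeberg.of_le_mul hL2 one_pos ?_
      filter_upwards [eventually_ge_atTop 1] with n hn
      rw [one_mul]
      exact Real.sqrt_le_sqrt (hassoc.sum_variance_block_le_of_le hL2 hmean (hle n hn))
    · refine AssocCLT.BlockLindeberg.of_le_mul hL2 two_pos ?_
      -- Any constant below 1 would do; `1 / 4` gives `s_n ≤ 2ν` eventually.
      filter_upwards [hs, hvar.eventually_const_le (by norm_num : (1 / 4 : ℝ) < 1)] with n hsn hn
      rw [le_div_iff₀ (by positivity)] at hn
      have : AssocCLT.sd P X n / 2 ≤ AssocCLT.blockNorm P X (ℓ n) (m n) := by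
        refine Real.le_sqrt_of_sq_le (le_trans (le_of_eq ?_) hn)
        ring
      linarith
  refine ⟨?_, hequiv⟩
  -- The approximate independence of the blocks: at `t / s_n` the variance gap becomes `2t²(1 -
  -- ν²/s_n²)`, which vanishes by (Ha). Each implication then transfers the Gaussian limit between
  -- `S_n / s_n` and the product.
  have hdiff : ∀ t : ℝ, Tendsto (fun n =>
      charFun (P.map (AssocCLT.partialSum X n)) (t / AssocCLT.sd P X n) -
        ∏ j ∈ Finset.Icc 1 (m n),
          charFun (P.map (AssocCLT.block X (ℓ n) j)) (t / AssocCLT.sd P X n)) atTop (𝓝 0) := by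
    intro t
    have hbound := (hvar.const_sub 1).const_mul (2 * t ^ 2)
    rw [sub_self, mul_zero] at hbound
    refine squeeze_zero_norm' ?_ hbound
    filter_upwards [hs, eventually_ge_atTop 1] with n hsn hn
    refine (hassoc.norm_charFun_partialSum_sub_prod_le_of_le hL2 hmean (hle n hn) _).trans
      (le_of_eq ?_)
    rw [← hsd]
    field_simp
  have hbm : ∀ n j, Measurable (AssocCLT.block X (ℓ n) j) := fun n j => by
    rw [AssocCLT.block_eq_sum]
    exact Finset.measurable_sum _ fun i _ => hmeas i
  have hbL : ∀ n j, MemLp (AssocCLT.block X (ℓ n) j) 2 P :=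
    fun n j => AssocCLT.memLp_block hL2 _ _
  have hb0 : ∀ n j, ∫ ω, AssocCLT.block X (ℓ n) j ω ∂P = 0 :=
    fun n j => AssocCLT.integral_block hL2 hmean _ _
  simp only [AssocCLT.variance_block hL2 hmean] at hvar
  rw [hequiv, AssocCLT.maxBlockNegligible_iff hs, AssocCLT.clt_iff_tendsto_charFun hmeas]
  constructor
  · rintro ⟨hneg, hclt⟩ ε hε
    exact AssocCLT.lindeberg_of_tendsto_prod_charFun hbm hbL hb0 hs hvar hneg
      (fun t => by simpa using (hclt t).sub (hdiff t)) hε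
  · intro hlin
    refine ⟨fun ε hε => AssocCLT.negligible_of_lindeberg hbm hbL hs hlin hε, fun t => ?_⟩
    simpa using (hdiff t).add
      (AssocCLT.tendsto_prod_charFun_of_lindeberg hbm hbL hb0 hs hvar hlin t)
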